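/- Let $n\ge 2$, fix points $\mathbf s=(s_1,\dots,s_n)\in\mathbb T^n=(S^1)^n$ and $\mathbf a=(a_1,\dots,a_n)\in\mathrm{Conf}(n)$, where $\mathrm{Conf}(n)=\{(x_1,\dots,x_n)\in(\mathbb R^3)^n : x_i\ne x_j \text{ for } i\ne j\}$. A link map is an $n$-tuple $L=(L_1,\dots,L_n)$ of smooth immersions $L_i\colon S^1\to\mathbb R^3$ with $L_i(S^1)\cap L_j(S^1)=\emptyset$ for $i\ne j$; it is pointed if $L_i(s_i)=a_i$ for all $i$. Let $\mathrm{link}$ and $\mathrm{link}_{\mathbf a}$ be the spaces of all link maps and of pointed link maps, with the compact-open topology (so that two link maps lie in the same path component exactly when they are joined by a continuous homotopy through (pointed) link maps, i.e. a link homotopy). Let $\mathrm{map}(\mathbb T^n,\mathrm{Conf}(n))$ be the space of continuous maps with the compact-open topology, and $\mathrm{map}_{\mathbf a}(\mathbb T^n,\mathrm{Conf}(n))$ its subspace of maps $f$ with $f(\mathbf s)=\mathbf a$. Sending $L$ to the map $(t_1,\dots,t_n)\mapsto(L_1(t_1),\dots,L_n(t_n))$ induces the pointed and the free $\kappa$-invariants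 $$\kappa\colon\pi_0(\mathrm{link}_{\mathbf a})\to\pi_0(\mathrm{map}_{\mathbf a}(\mathbb T^n,\mathrm{Conf}(n))),\qquad \kappa_{\mathrm{free}}\colon\pi_0(\mathrm{link})\to\pi_0(\mathrm{map}(\mathbb T^n,\mathrm{Conf}(n))).$$ Then the maps $$\pi_0(\mathrm{link}_{\mathbf a})\to\pi_0(\mathrm{link}),\qquad \pi_0(\mathrm{map}_{\mathbf a}(\mathbb T^n,\mathrm{Conf}(n)))\to\pi_0(\mathrm{map}(\mathbb T^n,\mathrm{Conf}(n)))$$ induced by the inclusions (forgetting base points) are bijections, and they form a commutative square with $\kappa$ and $\kappa_{\mathrm{free}}$. Consequently, $\kappa$ is injective if and only if $\kappa_{\mathrm{free}}$ is injective. -/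

import Mathlib

open scoped Manifold ContDiff

noncomputable section

namespace LinkKappa

/-- Euclidean three-space. -/
abbrev E3 : Type := EuclideanSpace ℝ (Fin 3)

/-- The space `Conf(ℝ³, n)` of ordered `n`-tuples of pairwise distinct points of `ℝ³`, with the
subspace topology. -/
abbrev Conf (n : ℕ) : Type := {x : Fin n → E3 // ∀ i j, i ≠ j → x i ≠ x j}

/-- The `n`-torus `S¹ × ⋯ × S¹`. -/
abbrev Torus (n : ℕ) : Type := Fin n → Circle

/-- `L = (L₁, …, Lₙ)` is a link map: every component is a smooth immersion of the circle into
`ℝ³`, and distinct components have disjoint images. -/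
structure IsLinkMap {n : ℕ} (L : Fin n → C(Circle, E3)) : Prop where
  immersion : ∀ i, Manifold.IsImmersion (𝓡 1) (𝓡 3) ∞ (L i)
  disjoint : ∀ i j, i ≠ j → Disjoint (Set.range (L i)) (Set.range (L j))

/-- The space of `n`-component link maps `S¹ ⊔ ⋯ ⊔ S¹ → ℝ³`, with the compact-open topology: a
path in it is a continuous homotopy through link maps, that is, a link homotopy. -/
abbrev LinkSpace (n : ℕ) : Type := {L : Fin n → C(Circle, E3) // IsLinkMap L}

/-- The subspace of link maps whose `i`-th component sends `sᵢ` to `aᵢ`. -/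
abbrev PointedLinkSpace {n : ℕ} (s : Torus n) (a : Conf n) : Type :=
  {L : LinkSpace n // ∀ i, L.1 i (s i) = a.1 i}

/-- The space of continuous maps from the torus to the configuration space, with the compact-open
topology. -/
abbrev MapSpace (n : ℕ) : Type := C(Torus n, Conf n)

/-- The subspace of maps that send the base point `s` to the base point `a`. -/
abbrev PointedMapSpace {n : ℕ} (s : Torus n) (a : Conf n) : Type :=
  {f : MapSpace n // f s = a}

/-- The map induced by a continuous map on sets of path components. -/
def pi0Map {X Y : Type*} [TopologicalSpace X] [TopologicalSpace Y] (f : C(X, Y)) :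
    ZerothHomotopy X → ZerothHomotopy Y :=
  ZerothHomotopy.lift (fun x => ZerothHomotopy.mk (f x))
    (fun _ _ p => ZerothHomotopy.sound (p.map f.continuous))

/-- The map `(t₁, …, tₙ) ↦ (L₁(t₁), …, Lₙ(tₙ))` from the torus to the configuration space. -/
def confMap {n : ℕ} (L : LinkSpace n) : MapSpace n where
  toFun t := ⟨fun i => L.1 i (t i), fun i j hij h =>
    Set.disjoint_left.1 (L.2.disjoint i j hij) ⟨t i, rfl⟩ ⟨t j, h.symm⟩⟩
  continuous_toFun := by fun_prop

/-- `L ↦ confMap L` as a continuous map between the function spaces. -/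
def freeKappaMap (n : ℕ) : C(LinkSpace n, MapSpace n) where
  toFun := confMap
  continuous_toFun := by
    refine ContinuousMap.continuous_of_continuous_uncurry _ (Continuous.subtype_mk ?_ _)
    refine continuous_pi fun i => ?_
    exact ((continuous_apply i).comp (continuous_subtype_val.comp continuous_fst)).eval
      ((continuous_apply i).comp continuous_snd)

/-- The restriction of `freeKappaMap` to pointed link maps and pointed maps. -/
def pointedKappaMap {n : ℕ} (s : Torus n) (a : Conf n) :
    C(PointedLinkSpace s a, PointedMapSpace s a) where
  toFun L := ⟨freeKappaMap n L.1, Subtype.ext (funext L.2)⟩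
  continuous_toFun :=
    ((freeKappaMap n).continuous.comp continuous_subtype_val).subtype_mk _

/-- The inclusion of pointed link maps into link maps. -/
def forgetLink {n : ℕ} (s : Torus n) (a : Conf n) : C(PointedLinkSpace s a, LinkSpace n) where
  toFun := Subtype.val
  continuous_toFun := continuous_subtype_val

/-- The inclusion of pointed maps into maps. -/
def forgetMap {n : ℕ} (s : Torus n) (a : Conf n) : C(PointedMapSpace s a, MapSpace n) where
  toFun := Subtype.val
  continuous_toFun := continuous_subtype_val

/-- The pointed `κ`-invariant, a map
`π₀(link_a(⊔ S¹; ℝ³)) → π₀(map_a(𝕋ⁿ, Conf(n)))`. -/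
def kappa {n : ℕ} (s : Torus n) (a : Conf n) :
    ZerothHomotopy (PointedLinkSpace s a) → ZerothHomotopy (PointedMapSpace s a) :=
  pi0Map (pointedKappaMap s a)

/-- The free `κ`-invariant, a map `π₀(link(⊔ S¹; ℝ³)) → π₀(map(𝕋ⁿ, Conf(n)))`. -/
def kappaFree (n : ℕ) : ZerothHomotopy (LinkSpace n) → ZerothHomotopy (MapSpace n) :=
  pi0Map (freeKappaMap n)

end LinkKappa

end

noncomputable section

namespace LinkKappa

open scoped unitInterval NNReal
open Set

/-! Both inclusions are inclusions of a fibre: pointed link maps and pointed maps form the fibre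
over `a` of evaluation at `s`, a map to `Conf n`. Two facts then suffice.

First, points of a configuration can be moved by ambient diffeomorphisms of `E3`. Postcomposing with
them turns a path in `Conf n` into a deformation of link maps, or of maps to `Conf n`, covering that
path (`exists_ambient`). This replaces the homotopy lifting property.

Second, `Conf n` is simply connected. A loop is deformed to a piecewise linear one and then coned
off to a configuration in general position; such a cone point exists because two difference vectors
span at most a plane in three-space.

As in the end of the long exact sequence of a fibration, connectedness of the base makes the fibre
inclusion surjective on path components and triviality of its loops makes it injective. Injectivity
of `kappa` then transfers across the commutative square. -/

/-! ### Transport and path components of fibres -/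

/-- A map has transport if every continuous family of paths in the base lifts to a continuous
family of self-maps of the total space that carry the fibre over the starting point of each path to
the fibre over its end point, constant paths being lifted to the identity. -/
def HasTransport {X B : Type*} [TopologicalSpace X] [TopologicalSpace B] (p : X → B) : Prop :=
  ∀ H : C(I × I, B), ∃ Φ : I × X → X, Continuous Φ ∧
    (∀ τ x, p x = H (0, τ) → p (Φ (τ, x)) = H (1, τ)) ∧
    ∀ τ, (∀ u, H (u, τ) = H (0, τ)) → ∀ x, Φ (τ, x) = x

/-- Over a simply connected base, the inclusion of a fibre of a map with transport is bijective on
path components. -/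
theorem HasTransport.bijective_pi0Map {X B : Type*} [TopologicalSpace X] [TopologicalSpace B]
    [SimplyConnectedSpace B] {p : X → B} (hp : HasTransport p) (hpc : Continuous p) {b : B}
    {q : X → Prop} (hq : ∀ x, q x ↔ p x = b) (f : C({x // q x}, X)) (hf : ∀ x, f x = x.1) :
    Function.Bijective (pi0Map f) := by
  constructor
  · intro x y
    induction x using ZerothHomotopy.rec with | mk x => ?_
    induction y using ZerothHomotopy.rec with | mk y => ?_
    intro h
    have hj : Joined (f x) (f y) := Quotient.exact h
    obtain ⟨L⟩ := hj
    rw [hf, hf] at L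
    have hx : p x.1 = b := (hq _).1 x.2
    have hy : p y.1 = b := (hq _).1 y.2
    -- The projection of `L` is a loop at `b`. Transport along `u ↦ F (u, τ)` pushes `L τ` into the
    -- fibre, and fixes the ends of `L` because `F` is constant there.
    obtain ⟨F⟩ := SimplyConnectedSpace.paths_homotopic ((L.map hpc).cast hx.symm hy.symm)
      (Path.refl b)
    obtain ⟨Φ, hΦ, hend, hconst⟩ := hp F.toContinuousMap
    have hstart : ∀ τ, F.toContinuousMap (0, τ) = p (L τ) := fun τ => F.apply_zero τ
    refine ZerothHomotopy.sound ⟨⟨fun τ => ⟨Φ (τ, L τ), (hq _).2 ?_⟩, by fun_prop⟩, ?_, ?_⟩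
    · rw [hend τ (L τ) (hstart τ).symm]
      exact F.apply_one τ
    · refine Subtype.ext ?_
      have := hconst 0 (fun u => (F.source u).trans (F.source 0).symm) (L 0)
      exact this.trans L.source
    · refine Subtype.ext ?_
      have := hconst 1 (fun u => (F.target u).trans (F.target 0).symm) (L 1)
      exact this.trans L.target
  · intro x
    induction x using ZerothHomotopy.rec with | mk x => ?_
    obtain ⟨γ⟩ := PathConnectedSpace.joined (p x) b
    -- For each `τ`, transport along the initial piece `u ↦ γ (u * τ)`: constant at `τ = 0`, all of
    -- `γ` at `τ = 1`.
    obtain ⟨Φ, hΦ, hend, hconst⟩ := hp ⟨fun z => γ (z.1 * z.2), by fun_prop⟩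
    refine ⟨ZerothHomotopy.mk ⟨Φ (1, x), (hq _).2 ?_⟩, ?_⟩
    · rw [hend 1 x (by simp)]
      simp
    · refine (ZerothHomotopy.sound ⟨⟨fun τ => Φ (τ, x), by fun_prop⟩, ?_, ?_⟩).symm
      · exact hconst 0 (by simp) x
      · rw [hf]

/-! ### Moving configurations by ambient diffeomorphisms -/

/-- Postcomposition with a homeomorphism that is smooth in both directions preserves immersions. -/
theorem isImmersion_comp_homeomorph {f : Circle → E3} (hf : Manifold.IsImmersion (𝓡 1) (𝓡 3) ∞ f)
    (φ : E3 ≃ₜ E3) (h : ContDiff ℝ ∞ φ) (h' : ContDiff ℝ ∞ φ.symm) :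
    Manifold.IsImmersion (𝓡 1) (𝓡 3) ∞ (φ ∘ f) := by
  obtain ⟨F, iF, jF, hF⟩ := hf
  refine ⟨F, iF, jF, fun x => ?_⟩
  have hx := hF x
  -- Precomposing the target chart with `φ.symm` leaves the coordinate expression of the immersion
  -- unchanged.
  refine Manifold.IsImmersionAtOfComplement.mk_of_charts (hx.equiv) hx.domChart
    (φ.symm.toOpenPartialHomeomorph.trans hx.codChart) hx.mem_domChart_source ?_
    hx.domChart_mem_maximalAtlas ?_ ?_ ?_
  · simpa using hx.mem_codChart_source
  · have hc := (IsManifold.mem_maximalAtlas_iff_contMDiffOn _).1 hx.codChart_mem_maximalAtlas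
    refine (IsManifold.mem_maximalAtlas_iff_contMDiffOn _).2 ⟨?_, ?_⟩
    · refine hc.1.comp (h'.contMDiff.contMDiffOn) ?_
      intro y hy
      simpa using hy
    · refine (h.contMDiff).comp_contMDiffOn (hc.2.mono ?_)
      intro y hy
      simpa using hy
  · intro y hy
    simpa using hx.source_subset_preimage_source hy
  · intro y hy
    simpa using hx.writtenInCharts hy

/-- A smooth perturbation of the identity with Lipschitz constant less than one is a homeomorphism
that is smooth in both directions. -/
theorem exists_homeomorph_id_add {E : Type*} [NormedAddCommGroup E] [NormedSpace ℝ E]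
    [CompleteSpace E] {g : E → E} {K : ℝ≥0} (hK : K < 1) (hg : LipschitzWith K g)
    (hs : ContDiff ℝ ∞ g) :
    ∃ φ : E ≃ₜ E, (∀ p, φ p = p + g p) ∧ ContDiff ℝ ∞ φ ∧ ContDiff ℝ ∞ φ.symm := by
  have ha : ApproximatesLinearOn (fun p => p + g p)
      ((ContinuousLinearEquiv.refl ℝ E : E ≃L[ℝ] E) : E →L[ℝ] E) univ K := by
    rw [ApproximatesLinearOn.approximatesLinearOn_iff_lipschitzOnWith]
    have : ((fun p => p + g p) - ((ContinuousLinearEquiv.refl ℝ E : E ≃L[ℝ] E) : E →L[ℝ] E)) = g := by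
      ext p; simp
    rw [this]
    exact hg.lipschitzOnWith
  have hc : Subsingleton E ∨
      K < ‖(((ContinuousLinearEquiv.refl ℝ E).symm : E ≃L[ℝ] E) : E →L[ℝ] E)‖₊⁻¹ := by
    rcases subsingleton_or_nontrivial E with hE | hE
    · exact Or.inl hE
    · right
      have : ‖(((ContinuousLinearEquiv.refl ℝ E).symm : E ≃L[ℝ] E) : E →L[ℝ] E)‖₊ = 1 :=
        NNReal.eq ContinuousLinearMap.norm_id
      rw [this]; simpa using hK
  have hsm : ContDiff ℝ ∞ (fun p => p + g p) := contDiff_id.add hs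
  refine ⟨ha.toHomeomorph _ hc, fun p => rfl, hsm, contDiff_iff_contDiffAt.2 fun y => ?_⟩
  set φ : E ≃ₜ E := ha.toHomeomorph _ hc with hφ
  have hdg : HasFDerivAt g (fderiv ℝ g (φ.symm y)) (φ.symm y) :=
    (hs.differentiable (by simp) _).hasFDerivAt
  have hn : ‖-fderiv ℝ g (φ.symm y)‖ < 1 := by
    rw [norm_neg]
    exact (norm_fderiv_le_of_lipschitz ℝ hg).trans_lt (by exact_mod_cast hK)
  -- The derivative `1 - (-Dg)` is invertible by the Neumann series, so the inverse function theorem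
  -- applies.
  let A : E ≃L[ℝ] E := ContinuousLinearEquiv.ofUnit (Units.oneSub _ hn)
  have hA : HasFDerivAt (fun p => p + g p) (A : E →L[ℝ] E) (φ.symm y) := by
    refine ((hasFDerivAt_id (φ.symm y)).add hdg).congr_fderiv ?_
    ext v
    change v + _ = (1 - -fderiv ℝ g (φ.symm y)) v
    simp
  exact OpenPartialHomeomorph.contDiffAt_symm φ.toOpenPartialHomeomorph (f₀' := A) (mem_univ _)
    hA hsm.contDiffAt

/-- A self-map of Euclidean space that sends link maps to link maps. -/
structure PreservesLinks (φ : E3 → E3) : Prop where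
  injective : Function.Injective φ
  immersion : ∀ f : Circle → E3, Manifold.IsImmersion (𝓡 1) (𝓡 3) ∞ f →
    Manifold.IsImmersion (𝓡 1) (𝓡 3) ∞ (φ ∘ f)

theorem PreservesLinks.comp {φ ψ : E3 → E3} (hφ : PreservesLinks φ) (hψ : PreservesLinks ψ) :
    PreservesLinks (φ ∘ ψ) :=
  ⟨hφ.injective.comp hψ.injective, fun f hf => hφ.immersion _ (hψ.immersion f hf)⟩

theorem PreservesLinks.id : PreservesLinks id := ⟨Function.injective_id, fun _ hf => hf⟩

/-- Pushing configurations along small displacements: for `m`-separated configurations `x` and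
close configurations `y` there are maps preserving links that carry `x` to `y`, depend
continuously on `x` and `y`, and are the identity for `y = x`. -/
theorem exists_push (n : ℕ) {m : ℝ} (hm : 0 < m) :
    ∃ δ > 0, ∃ P : (Fin n → E3) × (Fin n → E3) × E3 → E3, Continuous P ∧
      (∀ x p, P (x, x, p) = p) ∧
      ∀ x y : Fin n → E3, (∀ i j, i ≠ j → m ≤ dist (x i) (x j)) →
        (∀ i, P (x, y, x i) = y i) ∧ (dist x y < δ → PreservesLinks fun p => P (x, y, p)) := by
  -- The bump is `1` at `0` and vanishes at distance `m`, so at `x i` only the `i`-th summand of the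
  -- displacement below survives.
  let ψ : ContDiffBump (0 : E3) := ⟨m / 2, m, by positivity, by linarith⟩
  have hψs : ContDiff ℝ ∞ ψ := ψ.contDiff
  obtain ⟨C, hC⟩ := hψs.lipschitzWith_of_hasCompactSupport ψ.hasCompactSupport (by simp)
  -- The displacement is Lipschitz with constant `n * C * dist x y`; this `δ` makes it less than
  -- one.
  refine ⟨1 / (n * C + 1), by positivity,
    fun z => z.2.2 + ∑ i, ψ (z.2.2 - z.1 i) • (z.2.1 i - z.1 i), ?_, ?_, ?_⟩
  · have := ψ.continuous
    fun_prop
  · intro x p; simp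
  · intro x y hx
    constructor
    · intro i
      have h0 : ψ (x i - x i) = 1 := by
        rw [sub_self]
        exact ψ.one_of_mem_closedBall (by simp [ψ.rIn_pos.le])
      have h1 : ∀ j, j ≠ i → ψ (x i - x j) = 0 := by
        intro j hj
        refine ψ.zero_of_le_dist ?_
        rw [dist_zero_right, ← dist_eq_norm]
        exact hx i j hj.symm
      simp only
      rw [Finset.sum_eq_single i (fun j _ hj => by rw [h1 j hj, zero_smul]) (by simp), h0]
      simp
    · intro hd
      let g : E3 → E3 := fun p => ∑ i, ψ (p - x i) • (y i - x i)
      have hg : LipschitzWith (n * C * nndist x y) g := by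
        refine LipschitzWith.of_dist_le_mul fun p q => ?_
        rw [dist_eq_norm]
        simp only [g]
        rw [← Finset.sum_sub_distrib]
        refine (norm_sum_le _ _).trans ?_
        have : ∀ i ∈ Finset.univ, ‖ψ (p - x i) • (y i - x i) - ψ (q - x i) • (y i - x i)‖ ≤
            C * dist p q * dist x y := by
          intro i _
          rw [← sub_smul, norm_smul]
          have h1 := hC.dist_le_mul (p - x i) (q - x i)
          rw [dist_sub_right] at h1
          have h2 : ‖y i - x i‖ ≤ dist x y := by
            rw [← dist_eq_norm, dist_comm]
            exact dist_le_pi_dist x y i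
          gcongr
          exact h1
        refine (Finset.sum_le_sum this).trans ?_
        simp only [Finset.sum_const, Finset.card_univ, Fintype.card_fin, nsmul_eq_mul]
        push_cast
        apply le_of_eq; ring
      have hK : n * C * nndist x y < 1 := by
        rw [← NNReal.coe_lt_coe]
        push_cast
        rw [lt_div_iff₀ (by positivity)] at hd
        have : 0 ≤ dist x y := dist_nonneg
        rcases this.eq_or_lt with h | h
        · rw [← h]; simp
        · nlinarith
      have hs : ContDiff ℝ ∞ g := by
        refine ContDiff.sum fun i _ => ?_
        exact (hψs.comp (contDiff_id.sub contDiff_const)).smul contDiff_const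
      obtain ⟨φ, hφ, h1, h2⟩ := exists_homeomorph_id_add hK hg hs
      have he : (fun p => p + ∑ i, ψ (p - x i) • (y i - x i)) = φ := by
        ext1 p; exact (hφ p).symm
      change PreservesLinks (fun p => p + ∑ i, ψ (p - x i) • (y i - x i))
      rw [he]
      exact ⟨φ.injective, fun f hf => isImmersion_comp_homeomorph hf φ h1 h2⟩

/-- Distinct points of the configurations in a compact family are uniformly separated. -/
theorem exists_separation {n : ℕ} {K : Type*} [TopologicalSpace K] [CompactSpace K]
    (H : C(K, Conf n)) :
    ∃ m > 0, ∀ z i j, i ≠ j → m ≤ dist ((H z).1 i) ((H z).1 j) := by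
  have h : ∀ i j : Fin n, ∃ m > 0, i ≠ j → ∀ z, m ≤ dist ((H z).1 i) ((H z).1 j) := by
    intro i j
    by_cases hij : i = j
    · exact ⟨1, one_pos, fun h => absurd hij h⟩
    rcases isEmpty_or_nonempty K with hK | hK
    · exact ⟨1, one_pos, fun _ z => isEmptyElim z⟩
    have hc : Continuous fun z => dist ((H z).1 i) ((H z).1 j) :=
      (((continuous_apply i).comp continuous_subtype_val).comp H.continuous).dist
        (((continuous_apply j).comp continuous_subtype_val).comp H.continuous)
    obtain ⟨z, -, hz⟩ := isCompact_univ.exists_isMinOn univ_nonempty hc.continuousOn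
    exact ⟨_, dist_pos.2 ((H z).2 i j hij), fun _ w => hz (mem_univ w)⟩
  choose m hm h using h
  rcases isEmpty_or_nonempty (Fin n) with hn | hn
  · exact ⟨1, one_pos, fun _ i => isEmptyElim i⟩
  refine ⟨Finset.univ.inf' Finset.univ_nonempty fun p : Fin n × Fin n => m p.1 p.2, ?_, ?_⟩
  · simp [Finset.lt_inf'_iff, hm]
  · intro z i j hij
    exact (Finset.inf'_le _ (Finset.mem_univ (i, j))).trans (h i j hij z)

/-- Ambient isotopy: a continuous family of paths of configurations is covered by a continuous
family of maps preserving links. -/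
theorem exists_ambient {n : ℕ} (H : C(I × I, Conf n)) :
    ∃ φ : I × E3 → E3, Continuous φ ∧ (∀ τ, PreservesLinks fun p => φ (τ, p)) ∧
      (∀ τ i, φ (τ, (H (0, τ)).1 i) = (H (1, τ)).1 i) ∧
      ∀ τ, (∀ u, H (u, τ) = H (0, τ)) → ∀ p, φ (τ, p) = p := by
  obtain ⟨m, hm, hsep⟩ := exists_separation H
  obtain ⟨δ, hδ, P, hPc, hPid, hP⟩ := exists_push n hm
  have huc : UniformContinuous fun z => (H z).1 :=
    CompactSpace.uniformContinuous_of_continuous (by fun_prop)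
  obtain ⟨ε, hε, huc⟩ := Metric.uniformContinuous_iff.1 huc δ hδ
  obtain ⟨N, hN⟩ := exists_nat_one_div_lt hε
  -- Time is cut into `N + 1` steps so short that each moves the configuration by less than `δ`; the
  -- pushes are composed.
  let t : ℕ → I := fun k => projIcc 0 1 zero_le_one (k / (N + 1 : ℝ))
  have ht : ∀ k, dist (t k) (t (k + 1)) < ε := by
    intro k
    have h1 : dist (t k) (t (k + 1)) ≤ dist (k / (N + 1 : ℝ)) ((k + 1 : ℕ) / (N + 1 : ℝ)) := by
      simpa [t] using (LipschitzWith.projIcc (zero_le_one (α := ℝ))).dist_le_mul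
        (k / (N + 1 : ℝ)) ((k + 1 : ℕ) / (N + 1 : ℝ))
    refine h1.trans_lt ?_
    rw [Real.dist_eq, abs_sub_comm, ← sub_div]
    push_cast
    rw [add_sub_cancel_left, abs_of_pos (by positivity)]
    exact hN
  have key : ∀ k, ∃ φ : I × E3 → E3, Continuous φ ∧ (∀ τ, PreservesLinks fun p => φ (τ, p)) ∧
      (∀ τ i, φ (τ, (H (0, τ)).1 i) = (H (t k, τ)).1 i) ∧
      ∀ τ, (∀ u, H (u, τ) = H (0, τ)) → ∀ p, φ (τ, p) = p := by
    intro k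
    induction k with
    | zero =>
      have h0 : t 0 = 0 := by simp [t]
      exact ⟨fun z => z.2, continuous_snd, fun _ => PreservesLinks.id, fun τ i => by rw [h0],
        fun _ _ _ => rfl⟩
    | succ k ih =>
      obtain ⟨φ, hφ, h1, h2, h3⟩ := ih
      refine ⟨fun z => P ((H (t k, z.1)).1, (H (t (k + 1), z.1)).1, φ z), by fun_prop, ?_, ?_, ?_⟩
      · intro τ
        refine PreservesLinks.comp (φ := fun p => P ((H (t k, τ)).1, (H (t (k + 1), τ)).1, p))
          ((hP _ _ (hsep _)).2 (huc ?_)) (h1 τ)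
        simp only [Prod.dist_eq, dist_self]
        exact max_lt (ht k) hε
      · intro τ i
        simp only [h2]
        exact (hP _ _ (hsep _)).1 i
      · intro τ hτ p
        simp only [hτ, h3 τ hτ, hPid]
  obtain ⟨φ, h0, h1, h2, h3⟩ := key (N + 1)
  have h1' : t (N + 1) = 1 := by
    simp only [t]
    push_cast
    rw [div_self (by positivity)]
    simp
  refine ⟨φ, h0, h1, fun τ i => ?_, h3⟩
  rw [h2, h1']

/-! ### Transport for the evaluation maps -/

theorem hasTransport_link {n : ℕ} (s : Torus n) :
    HasTransport fun L : LinkSpace n => freeKappaMap n L s := by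
  intro H
  obtain ⟨φ, h0, h1, h2, h3⟩ := exists_ambient H
  have hφ : ∀ τ, Continuous fun p => φ (τ, p) := fun τ => by fun_prop
  refine ⟨fun z => ⟨fun i => (ContinuousMap.mk _ (hφ z.1)).comp (z.2.1 i),
    fun i => (h1 z.1).immersion _ (z.2.2.immersion i), fun i j hij => ?_⟩, ?_, ?_, ?_⟩
  · have := z.2.2.disjoint i j hij
    rw [Set.disjoint_left] at this ⊢
    rintro _ ⟨u, rfl⟩ ⟨v, hv⟩
    exact this ⟨u, rfl⟩ ⟨v, (h1 z.1).injective hv⟩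
  · refine Continuous.subtype_mk (continuous_pi fun i => ?_) _
    refine ContinuousMap.continuous_of_continuous_uncurry _ ?_
    have : Continuous fun w : (I × LinkSpace n) × Circle => w.1.2.1 i w.2 :=
      ((continuous_apply i).comp (continuous_subtype_val.comp
        (continuous_snd.comp continuous_fst))).eval continuous_snd
    exact h0.comp ((continuous_fst.comp continuous_fst).prodMk this)
  · intro τ L hL
    refine Subtype.ext (funext fun i => ?_)
    have : L.1 i (s i) = (H (0, τ)).1 i := congrFun (congrArg Subtype.val hL) i
    change φ (τ, L.1 i (s i)) = _
    rw [this, h2]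
  · intro τ hτ L
    refine Subtype.ext (funext fun i => ContinuousMap.ext fun u => ?_)
    exact h3 τ hτ _

theorem hasTransport_map {n : ℕ} (s : Torus n) :
    HasTransport fun f : MapSpace n => f s := by
  intro H
  obtain ⟨φ, h0, h1, h2, h3⟩ := exists_ambient H
  let G : I × Conf n → Conf n := fun z => ⟨fun i => φ (z.1, z.2.1 i), fun i j hij h =>
    z.2.2 i j hij ((h1 z.1).injective h)⟩
  have hG : Continuous G := Continuous.subtype_mk (continuous_pi fun i => h0.comp
    (continuous_fst.prodMk ((continuous_apply i).comp (continuous_subtype_val.comp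
      continuous_snd)))) _
  have hG' : ∀ τ, Continuous fun x => G (τ, x) := fun τ => by fun_prop
  refine ⟨fun z => (ContinuousMap.mk _ (hG' z.1)).comp z.2, ?_, ?_, ?_⟩
  · refine ContinuousMap.continuous_of_continuous_uncurry _ ?_
    have : Continuous fun w : (I × MapSpace n) × Torus n => w.1.2 w.2 :=
      (continuous_snd.comp continuous_fst).eval continuous_snd
    exact hG.comp ((continuous_fst.comp continuous_fst).prodMk this)
  · intro τ f hf
    refine Subtype.ext (funext fun i => ?_)
    have : f s = H (0, τ) := hf
    change φ (τ, (f s).1 i) = _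
    rw [this, h2]
  · intro τ hτ f
    refine ContinuousMap.ext fun t => Subtype.ext (funext fun i => ?_)
    exact h3 τ hτ _

/-! ### Simple connectivity of the configuration space -/

/-- A loop that bounds a free homotopy to a constant loop is null-homotopic. -/
theorem homotopic_refl_of_free {X : Type*} [TopologicalSpace X] {x : X} (γ : Path x x)
    (F : C(I × I, X)) (c : X) (h0 : ∀ t, F (0, t) = γ t) (h1 : ∀ t, F (1, t) = c)
    (hF : ∀ u, F (u, 0) = F (u, 1)) : γ.Homotopic (Path.refl x) := by
  let G : C(ℝ × ℝ, X) := F.comp ⟨fun z => (projIcc 0 1 zero_le_one z.1, projIcc 0 1 zero_le_one z.2),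
    by fun_prop⟩
  have hG : ∀ u t : I, G (u, t) = F (u, t) := fun u t => by simp [G]
  let bot : Path ((0, 0) : ℝ × ℝ) (0, 1) := ⟨⟨fun t => (0, t), by fun_prop⟩, by simp, by simp⟩
  let left : Path ((0, 0) : ℝ × ℝ) (1, 0) := ⟨⟨fun t => (t, 0), by fun_prop⟩, by simp, by simp⟩
  let top : Path ((1, 0) : ℝ × ℝ) (1, 1) := ⟨⟨fun t => (1, t), by fun_prop⟩, by simp, by simp⟩
  let right : Path ((0, 1) : ℝ × ℝ) (1, 1) := ⟨⟨fun t => (t, 1), by fun_prop⟩, by simp, by simp⟩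
  -- The plane is simply connected, so the bottom edge is homotopic to the other three. Their image
  -- is `β`, a constant path, then `β` reversed.
  have hsq : bot.Homotopic ((left.trans top).trans right.symm) :=
    SimplyConnectedSpace.paths_homotopic _ _
  have hsq := hsq.map G
  have e0 : x = G (0, 0) := by rw [← γ.source, ← h0]; exact (hG 0 0).symm
  have e1 : x = G (0, 1) := by rw [← γ.target, ← h0]; exact (hG 0 1).symm
  have ec : c = G (1, 0) := by rw [← h1 0]; exact (hG 1 0).symm
  have ec' : c = G (1, 1) := by rw [← h1 1]; exact (hG 1 1).symm
  let β : Path x c := (left.map G.continuous).cast e0 ec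
  have hγ : γ = (bot.map G.continuous).cast e0 e1 := by
    ext t; exact ((hG 0 t).trans (h0 t)).symm
  have htop : (top.map G.continuous).cast ec ec' = Path.refl c := by
    ext t; exact (hG 1 t).trans (h1 t)
  have hβ : (right.map G.continuous).cast e1 ec' = β := by
    ext t; exact (hG t 1).trans ((hF t).symm.trans (hG t 0).symm)
  have hfin : (((left.trans top).trans right.symm).map G.continuous).cast e0 e1 =
      (β.trans (Path.refl c)).trans β.symm := by
    ext t
    simp only [Path.cast_coe, Path.map_coe, Function.comp_apply, Path.trans_apply]
    split_ifs
    · rfl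
    · exact congrArg (fun p : Path c c => p _) htop
    · exact congrArg (fun p : Path x c => p.symm _) hβ
  have h := hsq.pathCast e0 e1
  rw [hfin, ← hγ] at h
  exact h.trans (((Path.Homotopic.hcomp ⟨Path.Homotopy.transRefl β⟩ (.refl _)).trans
    (.symm ⟨Path.Homotopy.reflTransSymm β⟩)))

/-- The segment joining two points avoids `0` if the endpoint is not a multiple of the starting
point. -/
theorem lineMap_ne_zero {E : Type*} [AddCommGroup E] [Module ℝ E] {z c : E} (hz : z ≠ 0)
    {S : Submodule ℝ E} (hzS : z ∈ S) (hc : c ∉ S) (r : ℝ) : (1 - r) • z + r • c ≠ 0 := by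
  intro h
  by_cases hr : r = 0
  · subst hr; simp [hz] at h
  · refine hc ?_
    have h2 : r • c ∈ S := by
      rw [eq_neg_of_add_eq_zero_right h]
      exact S.neg_mem (S.smul_mem _ hzS)
    exact (S.smul_mem_iff hr).1 h2

/-- A point in general position with respect to finitely many segments of configurations. -/
theorem exists_general_position {n : ℕ} {κ : Type*} [Finite κ] (x y : κ → Fin n → E3) :
    ∃ c : Fin n → E3, ∀ k i j, i ≠ j →
      c i - c j ∉ Submodule.span ℝ {x k i - x k j, y k i - y k j} := by
  by_contra! hcon
  let p : κ × {q : Fin n × Fin n // q.1 ≠ q.2} → Subspace ℝ (Fin n → E3) := fun r =>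
    (Submodule.span ℝ {x r.1 r.2.1.1 - x r.1 r.2.1.2, y r.1 r.2.1.1 - y r.1 r.2.1.2}).comap
      (LinearMap.proj (R := ℝ) (φ := fun _ : Fin n => E3) r.2.1.1 - LinearMap.proj r.2.1.2)
  -- Finitely many proper subspaces cannot cover a real vector space, so one bad subspace is
  -- everything, and two vectors would span `E3`.
  obtain ⟨r, hr⟩ := Subspace.exists_eq_top_of_iUnion_eq_univ (p := p) (by
    refine eq_univ_of_forall fun c => ?_
    obtain ⟨k, i, j, hij, h⟩ := hcon c
    exact mem_iUnion.2 ⟨(k, ⟨(i, j), hij⟩), h⟩)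
  have htop : Submodule.span ℝ {x r.1 r.2.1.1 - x r.1 r.2.1.2, y r.1 r.2.1.1 - y r.1 r.2.1.2} = ⊤ := by
    rw [eq_top_iff]
    intro v _
    have : Pi.single r.2.1.1 v ∈ p r := by rw [hr]; trivial
    simpa [p, Pi.single_eq_of_ne r.2.2.symm] using this
  have h1 : Module.finrank ℝ (⊤ : Submodule ℝ E3) ≤ 2 := by
    rw [← htop]
    classical
    have := finrank_span_finset_le_card (R := ℝ)
      ({x r.1 r.2.1.1 - x r.1 r.2.1.2, y r.1 r.2.1.1 - y r.1 r.2.1.2} : Finset E3)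
    rw [Finset.coe_pair] at this
    exact this.trans Finset.card_le_two
  rw [finrank_top, finrank_euclideanSpace_fin] at h1
  omega

/-- The configurations on a segment towards a point in general position. -/
theorem cone_mem_conf {n : ℕ} {x y c z : Fin n → E3}
    (hc : ∀ i j, i ≠ j → c i - c j ∉ Submodule.span ℝ {x i - x j, y i - y j})
    (hz : z ∈ segment ℝ x y) (hzc : ∀ i j, i ≠ j → z i ≠ z j) (r : ℝ) (i j : Fin n) (hij : i ≠ j) :
    ((1 - r) • z + r • c) i ≠ ((1 - r) • z + r • c) j := by
  obtain ⟨a, b, -, -, -, rfl⟩ := hz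
  have hmem : (a • x + b • y) i - (a • x + b • y) j ∈
      Submodule.span ℝ {x i - x j, y i - y j} := by
    have : (a • x + b • y) i - (a • x + b • y) j = a • (x i - x j) + b • (y i - y j) := by
      simp only [Pi.add_apply, Pi.smul_apply]; module
    rw [this]
    exact add_mem (Submodule.smul_mem _ _ (Submodule.subset_span (by simp)))
      (Submodule.smul_mem _ _ (Submodule.subset_span (by simp)))
  have := lineMap_ne_zero (sub_ne_zero.2 (hzc i j hij)) hmem (hc i j hij) r
  intro h
  refine this ?_
  rw [← sub_eq_zero] at h
  rw [← h]
  simp only [Pi.add_apply, Pi.smul_apply]; module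

/-- Straight segments join both configurations to a common one in general position; the segments fed
to `exists_general_position` are degenerate. -/
theorem joined_conf {n : ℕ} (a b : Conf n) : Joined a b := by
  obtain ⟨c, hc⟩ := exists_general_position (κ := Bool) (fun k => bif k then a.1 else b.1)
    (fun k => bif k then a.1 else b.1)
  have hcc : ∀ i j, i ≠ j → c i ≠ c j := fun i j hij h => hc true i j hij (by simp [h])
  have key : ∀ x : Conf n, (∀ i j, i ≠ j → c i - c j ∉
      Submodule.span ℝ {x.1 i - x.1 j, x.1 i - x.1 j}) → Joined x ⟨c, hcc⟩ := by
    intro x hx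
    refine ⟨⟨⟨fun t => ⟨(1 - t.1) • x.1 + t.1 • c,
      cone_mem_conf hx (left_mem_segment _ _ _) x.2 t.1⟩, by fun_prop⟩, ?_, ?_⟩⟩
    · ext1; simp
    · ext1; simp
  exact (key a (hc true)).trans (key b (hc false)).symm

/-- Piecewise linear interpolation of a path, written with hat functions. -/
def interpolate {V : Type*} [AddCommGroup V] [Module ℝ V] (γ : I → V) (N : ℕ) (t : ℝ) : V :=
  -- The extra hat at `k = N + 1`, whose node is clamped to `1`, lets `interpolate_eq` include `k =
  -- N`, needed at `t = 1`.
  ∑ k ∈ Finset.range (N + 2), max 0 (1 - |N * t - k|) • γ (projIcc 0 1 zero_le_one (k / N))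

theorem continuous_interpolate {V : Type*} [AddCommGroup V] [Module ℝ V] [TopologicalSpace V]
    [ContinuousAdd V] [ContinuousSMul ℝ V] (γ : I → V) (N : ℕ) :
    Continuous (interpolate γ N) := by
  unfold interpolate
  fun_prop

theorem interpolate_eq {V : Type*} [AddCommGroup V] [Module ℝ V] (γ : I → V) {N k : ℕ}
    (hk : k ≤ N) {t : ℝ} (h1 : k ≤ N * t) (h2 : N * t ≤ k + 1) :
    interpolate γ N t = (1 - (N * t - k)) • γ (projIcc 0 1 zero_le_one (k / N)) +
      (N * t - k) • γ (projIcc 0 1 zero_le_one ((k + 1 : ℕ) / N)) := by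
  unfold interpolate
  rw [← Finset.sum_subset (s₁ := {k, k + 1})]
  · rw [Finset.sum_pair (by simp)]
    congr 2
    · rw [abs_of_nonneg (by linarith), max_eq_right (by linarith)]
    · push_cast
      rw [abs_of_nonpos (by linarith), max_eq_right (by linarith)]
      ring
  · intro l; simp only [Finset.mem_insert, Finset.mem_singleton, Finset.mem_range]; omega
  · intro l _ hl
    simp only [Finset.mem_insert, Finset.mem_singleton, not_or] at hl
    rw [max_eq_left, zero_smul]
    rcases lt_or_gt_of_ne hl.1 with h | h
    · have : (l : ℝ) + 1 ≤ k := by exact_mod_cast h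
      rw [sub_nonpos, le_abs]; left; linarith
    · have : (k : ℝ) + 2 ≤ l := by
        have : k + 2 ≤ l := by omega
        exact_mod_cast this
      rw [sub_nonpos, le_abs]; right; linarith

/-- A close piecewise linear loop has finitely many segments, so a single cone point is in general
position to all of them. -/
theorem loop_conf_nullhomotopic {n : ℕ} (a : Conf n) (γ : Path a a) :
    γ.Homotopic (Path.refl a) := by
  obtain ⟨m, hm, hsep⟩ := exists_separation γ.toContinuousMap
  have huc : UniformContinuous fun z => (γ z).1 :=
    CompactSpace.uniformContinuous_of_continuous (by fun_prop)
  -- Points at least `m` apart stay distinct when each moves by less than `m / 2`.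
  obtain ⟨ε, hε, huc⟩ := Metric.uniformContinuous_iff.1 huc (m / 2) (by positivity)
  obtain ⟨N', hN'⟩ := exists_nat_one_div_lt hε
  obtain ⟨N, rfl⟩ : ∃ N, N = N' + 1 := ⟨_, rfl⟩
  set N := N' + 1 with hNdef
  have hNpos : (0 : ℝ) < N := by positivity
  have hNε : 1 / (N : ℝ) < ε := by simpa [hNdef] using hN'
  let v : I → Fin n → E3 := fun t => (γ t).1
  let q : ℕ → I := fun k => projIcc 0 1 zero_le_one ((k : ℝ) / N)
  let P : ℝ → Fin n → E3 := interpolate v N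
  have hPc : Continuous P := continuous_interpolate v N
  have hq : ∀ (t : I) (l : ℕ), |N * t.1 - l| ≤ 1 → dist (v (q l)) (v t) < m / 2 := by
    intro t l h
    refine huc (lt_of_le_of_lt ?_ hNε)
    have h1 : dist (q l) (projIcc 0 1 zero_le_one t.1) ≤ dist ((l : ℝ) / N) t.1 := by
      simpa using (LipschitzWith.projIcc (zero_le_one (α := ℝ))).dist_le_mul ((l : ℝ) / N) t.1
    rw [projIcc_val] at h1
    refine h1.trans ?_
    have e : N * t.1 - l = (t.1 - l / N) * N := by field_simp
    rw [e, abs_mul, abs_of_pos hNpos] at h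
    rwa [Real.dist_eq, abs_sub_comm, le_div_iff₀ hNpos]
  have hP : ∀ t : I, ∃ k ∈ Finset.range (N + 1), P t ∈ segment ℝ (v (q k)) (v (q (k + 1))) ∧
      dist (P t) (v t) < m / 2 := by
    intro t
    have hnn : 0 ≤ N * t.1 := mul_nonneg hNpos.le t.2.1
    have h1 : (⌊N * t.1⌋₊ : ℝ) ≤ N * t.1 := Nat.floor_le hnn
    have h2 : N * t.1 ≤ ⌊N * t.1⌋₊ + 1 := (Nat.lt_floor_add_one _).le
    have hk : ⌊N * t.1⌋₊ ≤ N := by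
      have : (⌊N * t.1⌋₊ : ℝ) ≤ N := h1.trans (mul_le_of_le_one_right hNpos.le t.2.2)
      exact_mod_cast this
    have hseg : P t ∈ segment ℝ (v (q ⌊N * t.1⌋₊)) (v (q (⌊N * t.1⌋₊ + 1))) :=
      ⟨1 - (N * t.1 - ⌊N * t.1⌋₊), N * t.1 - ⌊N * t.1⌋₊, by linarith, by linarith, by ring,
        (interpolate_eq v hk h1 h2).symm⟩
    refine ⟨_, Finset.mem_range.2 (Nat.lt_succ_of_le hk), hseg, ?_⟩
    refine (convex_ball (v t) (m / 2)).segment_subset (hq t _ ?_) (hq t _ ?_) hseg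
    · rw [abs_le]; constructor <;> linarith
    · push_cast; rw [abs_le]; constructor <;> linarith
  have hlin : ∀ (t u : I) (i j : Fin n), i ≠ j →
      ((1 - u.1) • v t + u.1 • P t) i ≠ ((1 - u.1) • v t + u.1 • P t) j := by
    intro t u i j hij h
    obtain ⟨-, -, -, hd⟩ := hP t
    have hb : (1 - u.1) • v t + u.1 • P t ∈ Metric.ball (v t) (m / 2) :=
      convex_ball (v t) (m / 2) (Metric.mem_ball_self (by positivity)) hd (by linarith [u.2.2])
        u.2.1 (by ring)
    have hi := (dist_le_pi_dist _ _ i).trans_lt hb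
    have hj := (dist_le_pi_dist _ _ j).trans_lt hb
    have hs := hsep t i j hij
    have htri := dist_triangle_left (v t i) (v t j) (((1 - u.1) • v t + u.1 • P t) i)
    rw [h] at htri hi
    change m ≤ dist (v t i) (v t j) at hs
    linarith
  have hPconf : ∀ (t : I) (i j : Fin n), i ≠ j → P t i ≠ P t j := by
    intro t i j hij
    simpa using hlin t 1 i j hij
  have hP0 : P 0 = a.1 := by
    have := interpolate_eq v (N := N) (k := 0) (Nat.zero_le _) (t := 0) (by simp) (by simp)
    simp only [P, this]
    simp [v]
  have hP1 : P 1 = a.1 := by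
    have := interpolate_eq v (N := N) (k := N) le_rfl (t := 1) (by simp) (by simp)
    simp only [P, this]
    simp [v]
  let Q : Path a a := ⟨⟨fun t => ⟨P t, hPconf t⟩, by fun_prop⟩,
    Subtype.ext (by simpa using hP0), Subtype.ext (by simpa using hP1)⟩
  have hγQ : γ.Homotopic Q := by
    refine ⟨⟨⟨⟨fun z => ⟨(1 - z.1.1) • v z.2 + z.1.1 • P z.2, hlin z.2 z.1⟩, ?_⟩, ?_, ?_⟩, ?_⟩⟩
    · have : Continuous v := by fun_prop
      fun_prop
    · intro t; ext1; simp [v]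
    · intro t; ext1; simp [Q]
    · rintro u t (rfl | rfl)
      · ext1; simp [v, hP0, ← add_smul]
      · ext1; simp [v, hP1, ← add_smul]
  obtain ⟨c, hc⟩ := exists_general_position (κ := Finset.range (N + 1))
    (fun k => v (q k)) (fun k => v (q (k + 1)))
  have hcone : ∀ (r : ℝ) (t : I) (i j : Fin n), i ≠ j →
      ((1 - r) • P t + r • c) i ≠ ((1 - r) • P t + r • c) j := by
    intro r t
    obtain ⟨k, hk, hseg, -⟩ := hP t
    exact cone_mem_conf (hc ⟨k, hk⟩) hseg (hPconf t) r
  -- Coning moves the base point, so it gives only a free homotopy to a constant loop.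
  refine hγQ.trans (homotopic_refl_of_free Q
    ⟨fun z => ⟨(1 - z.1.1) • P z.2 + z.1.1 • c, hcone z.1 z.2⟩, by fun_prop⟩
    ⟨c, fun i j hij => by simpa using hcone 1 0 i j hij⟩ ?_ ?_ ?_)
  · intro t; ext1; simp [Q]
  · intro t; ext1; simp
  · intro u; ext1; simp [hP0, hP1]

theorem simplyConnectedSpace_conf {n : ℕ} (a : Conf n) : SimplyConnectedSpace (Conf n) :=
  simply_connected_iff_loops_nullhomotopic.2
    ⟨⟨⟨a⟩, joined_conf⟩, fun x γ => loop_conf_nullhomotopic x γ⟩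

end LinkKappa

end

theorem mainTheorem10 (n : ℕ) (hn : 2 ≤ n) (s : LinkKappa.Torus n) (a : LinkKappa.Conf n) :
    Function.Bijective (LinkKappa.pi0Map (LinkKappa.forgetLink s a)) ∧
    Function.Bijective (LinkKappa.pi0Map (LinkKappa.forgetMap s a)) ∧
    (∀ x : ZerothHomotopy (LinkKappa.PointedLinkSpace s a),
      LinkKappa.kappaFree n (LinkKappa.pi0Map (LinkKappa.forgetLink s a) x) =
        LinkKappa.pi0Map (LinkKappa.forgetMap s a) (LinkKappa.kappa s a x)) ∧
    (Function.Injective (LinkKappa.kappa s a) ↔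
      Function.Injective (LinkKappa.kappaFree n)) := by
  have := LinkKappa.simplyConnectedSpace_conf a
  have hlink : Function.Bijective (LinkKappa.pi0Map (LinkKappa.forgetLink s a)) :=
    (LinkKappa.hasTransport_link s).bijective_pi0Map (b := a)
      ((continuous_eval_const s).comp (LinkKappa.freeKappaMap n).continuous)
      (fun L => ⟨fun h => Subtype.ext (funext h), fun h i => congrFun (congrArg Subtype.val h) i⟩)
      (LinkKappa.forgetLink s a) (fun _ => rfl)
  have hmap : Function.Bijective (LinkKappa.pi0Map (LinkKappa.forgetMap s a)) :=
    (LinkKappa.hasTransport_map s).bijective_pi0Map (b := a)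
      (continuous_eval_const s) (fun f => Iff.rfl)
      (LinkKappa.forgetMap s a) (fun _ => rfl)
  have hcomm : ∀ x : ZerothHomotopy (LinkKappa.PointedLinkSpace s a),
      LinkKappa.kappaFree n (LinkKappa.pi0Map (LinkKappa.forgetLink s a) x) =
        LinkKappa.pi0Map (LinkKappa.forgetMap s a) (LinkKappa.kappa s a x) := by
    intro x
    induction x using ZerothHomotopy.rec with | mk x => rfl
  refine ⟨hlink, hmap, hcomm, ?_⟩
  rw [← hmap.1.of_comp_iff, ← Function.Injective.of_comp_iff' _ hlink]
  exact iff_of_eq (congrArg Function.Injective (funext fun x => (hcomm x).symm))
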